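/- Let $d \ge 1$ be an integer, $p > d$ and $\delta > 0$ real numbers, and $B \subset \mathbb{R}^d$ an open ball. For a measurable function $u : B \to \mathbb{R}$ set $$ I_{\delta,p}(u,B) = \mathop{\int_B\int_B}_{|u(x)-u(y)|>\delta} \frac{\delta^p}{|x-y|^{d+p}}\,dx\,dy \in [0,\infty], $$ let $|B|$ be the Lebesgue measure of $B$, and, for $u \in L^1(B)$, let $u_B = \frac{1}{|B|}\int_B u\,dx$. i) For all $M > 0$ and $\alpha > 0$ there is a constant $0 < \beta = \beta(\alpha,M) \le 1$, depending only on $\alpha$ and $M$, such that every measurable $u : B \to \mathbb{R}$ with $|B|^{\frac{p-d}{d}}\,\delta^{-p}\, I_{\delta,p}(u,B) \le M$ belongs to $L^1(B)$ and satisfies $$ \frac{1}{|B|}\int_B \exp\Big(\alpha \big(\tfrac{p}{d}\big)^{\beta\,\delta^{-1}|u-u_B|}\Big)\,dx \le C . $$ ii) For every $\alpha > 0$ there is a constant $M_0 > 0$, depending only on $\alpha$, $d$ and $p$, such that every measurable $u : B \to \mathbb{R}$ with $|B|^{\frac{p-d}{d}}\,\delta^{-p}\, I_{\delta,p}(u,B)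 \le M_0$ belongs to $L^1(B)$ and satisfies $$ \frac{1}{|B|}\int_B \exp\Big(\alpha \big(\tfrac{p}{d}\big)^{\delta^{-1}|u-u_B|}\Big)\,dx \le C . $$ Here $C > 0$ is a constant depending only on $d$, $p$ and $\alpha$ (in particular not on $M$, $\delta$, $B$ or $u$). -/

import Mathlib

open MeasureTheory
open scoped ENNReal

noncomputable section

/-- The nonlocal energy
`I_{δ,p}(u, O) = ∫_O ∫_O 1_{|u(x) - u(y)| > δ} δ^p / |x - y|^{d+p} dx dy`, with values in `[0, ∞]`.
Here `|x - y|` is the Euclidean distance of `ℝ^d`; for `δ > 0` the diagonal `x = y` does not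
contribute because there `|u(x) - u(y)| = 0`. -/
def nonlocalEnergy (d : ℕ) (δ p : ℝ) (u : EuclideanSpace ℝ (Fin d) → ℝ)
    (O : Set (EuclideanSpace ℝ (Fin d))) : ℝ≥0∞ :=
  ∫⁻ x in O, ∫⁻ y in O,
    if δ < |u x - u y| then ENNReal.ofReal (δ ^ p / ‖x - y‖ ^ ((d : ℝ) + p)) else 0

/-- The scale-invariant quantity `|O|^{(p-d)/d} δ^{-p} I_{δ,p}(u, O)`. -/
def normalizedEnergy (d : ℕ) (δ p : ℝ) (u : EuclideanSpace ℝ (Fin d) → ℝ)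
    (O : Set (EuclideanSpace ℝ (Fin d))) : ℝ≥0∞ :=
  ENNReal.ofReal (volume.real O ^ ((p - d) / d) * δ ^ (-p)) * nonlocalEnergy d δ p u O

/-- The average `⨍_O exp (α (p/d)^{β δ⁻¹ |u - u_O|}) dx`, with values in `[0, ∞]`,
where `u_O = ⨍_O u`. -/
def doubleExpAverage (d : ℕ) (δ p α β : ℝ) (u : EuclideanSpace ℝ (Fin d) → ℝ)
    (O : Set (EuclideanSpace ℝ (Fin d))) : ℝ≥0∞ :=
  ⨍⁻ x in O,
    ENNReal.ofReal (Real.exp (α * (p / d) ^ (β * δ⁻¹ * |u x - ⨍ y in O, u y ∂volume|))) ∂volume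

end

/-! Put `q = p / d > 1`, let `μ` be the uniform probability on the ball, `m` a median of `u`, `v =
(u - m) / δ` and `h t = μ {v > t}`. With the energy bounded by `M`, two inequalities for `h` carry
the proof.

Self-improvement (`measureReal_superlevel_succ_le`): `h (t + 1) ≤ c M (h t) ^ q`. Once `h` is below
a threshold of order `M ^ (-1 / (q - 1))`, iteration gives `h (K + t) ≲ exp (-c' q ^ t)`
(`double_exp_decay`), hence a double exponential integral.

Reaching that threshold (`measureReal_superlevel_succ_le_diff`): unless much mass of `v` lies in
`(t, t + 1]`, points with `v > t + 1` and points with `v ≤ t` come close together often, at high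
energy cost. So `h` drops by a definite amount per level, and the threshold is reached at a level
`K` polynomial in `M` (`exists_level_bound`).

In (i), `β = exp (-M) / 2` beats this polynomial, so `β K` is bounded independently of `M`; and `β ≤
1 / 2` lets Young's inequality absorb any `α`. In (ii), a small energy puts the median level itself
below the threshold, so `K = 0` and `β = 1` is allowed. Everything is applied to both `v` and `-v`.
-/

/-- The uniform probability measure on the ball `B(z, r)`. -/
noncomputable def uniformBall {d : ℕ} (z : EuclideanSpace ℝ (Fin d)) (r : ℝ) :
    Measure (EuclideanSpace ℝ (Fin d)) :=
  (volume.restrict (Metric.ball z r) Set.univ)⁻¹ • volume.restrict (Metric.ball z r)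

/-! ### Geometry of the uniform measure on a ball. -/

section Geometry

variable {d : ℕ} {z : EuclideanSpace ℝ (Fin d)} {r : ℝ}

theorem volume_ball_ne_zero (hr : 0 < r) : volume (Metric.ball z r) ≠ 0 :=
  (Metric.measure_ball_pos volume z hr).ne'

theorem uniformBall_apply {S : Set (EuclideanSpace ℝ (Fin d))} (hS : MeasurableSet S) :
    uniformBall z r S = (volume (Metric.ball z r))⁻¹ * volume (S ∩ Metric.ball z r) := by
  simp [uniformBall, Measure.restrict_apply hS]

theorem isProbabilityMeasure_uniformBall (hr : 0 < r) : IsProbabilityMeasure (uniformBall z r) := by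
  refine ⟨?_⟩
  rw [uniformBall_apply MeasurableSet.univ, Set.univ_inter]
  exact ENNReal.inv_mul_cancel (volume_ball_ne_zero hr) measure_ball_lt_top.ne

theorem ae_uniformBall_mem (z : EuclideanSpace ℝ (Fin d)) (r : ℝ) :
    ∀ᵐ x ∂(uniformBall z r), x ∈ Metric.ball z r :=
  Measure.ae_smul_measure (ae_restrict_mem measurableSet_ball) _

/-- The contraction of `B(z, r)` by the factor `s` towards `x` stays inside `B(z, r)` by convexity,
and inside `B(x, 2rs)` because its points come from points at distance less than `2r` from `x`. -/
theorem uniformBall_ball_ge (hr : 0 < r) {x : EuclideanSpace ℝ (Fin d)}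
    (hx : x ∈ Metric.ball z r) {s : ℝ} (hs : 0 < s) (hs1 : s ≤ 1) :
    ENNReal.ofReal (s ^ d) ≤ uniformBall z r (Metric.ball x (2 * r * s)) := by
  rw [uniformBall_apply measurableSet_ball]
  have hsub : Metric.ball (x + s • (z - x)) (s * r) ⊆
      Metric.ball x (2 * r * s) ∩ Metric.ball z r := by
    intro y hy
    rw [Metric.mem_ball, dist_eq_norm] at hy hx
    constructor
    · rw [Metric.mem_ball, dist_eq_norm]
      calc ‖y - x‖ = ‖(y - (x + s • (z - x))) - s • (x - z)‖ := by congr 1; module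
        _ ≤ ‖y - (x + s • (z - x))‖ + ‖s • (x - z)‖ := norm_sub_le _ _
        _ = ‖y - (x + s • (z - x))‖ + s * ‖x - z‖ := by
          rw [norm_smul, Real.norm_of_nonneg hs.le]
        _ < 2 * r * s := by nlinarith
    · rw [Metric.mem_ball, dist_eq_norm]
      calc ‖y - z‖ = ‖(y - (x + s • (z - x))) + (1 - s) • (x - z)‖ := by congr 1; module
        _ ≤ ‖y - (x + s • (z - x))‖ + ‖(1 - s) • (x - z)‖ := norm_add_le _ _
        _ = ‖y - (x + s • (z - x))‖ + (1 - s) * ‖x - z‖ := by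
          rw [norm_smul, Real.norm_of_nonneg (by linarith)]
        _ < r := by nlinarith
  have h1 : volume (Metric.ball (x + s • (z - x)) (s * r)) =
      ENNReal.ofReal (s ^ d) * volume (Metric.ball z r) := by
    rw [Measure.addHaar_ball_mul_of_pos volume _ hs, Measure.addHaar_ball_center volume z]
    simp
  calc ENNReal.ofReal (s ^ d)
      = (volume (Metric.ball z r))⁻¹ *
        (ENNReal.ofReal (s ^ d) * volume (Metric.ball z r)) := by
        rw [mul_comm (ENNReal.ofReal (s ^ d)), ← mul_assoc,
          ENNReal.inv_mul_cancel (volume_ball_ne_zero hr) measure_ball_lt_top.ne, one_mul]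
    _ ≤ _ := by
        rw [← h1]
        gcongr

/-- For fixed `x`, `y ↦ midpoint x y` is a contraction by `1 / 2` that preserves the ball, so
preimages gain at most the Jacobian factor `2 ^ d`. -/
theorem uniformBall_midpoint_le {x : EuclideanSpace ℝ (Fin d)}
    (hx : x ∈ Metric.ball z r) {S : Set (EuclideanSpace ℝ (Fin d))} (hS : MeasurableSet S) :
    uniformBall z r {y | midpoint ℝ x y ∈ S} ≤ 2 ^ d * uniformBall z r S := by
  have hmeas : MeasurableSet {y | midpoint ℝ x y ∈ S} := by
    have : Measurable fun y => midpoint ℝ x y := by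
      simp only [midpoint_eq_smul_add]
      fun_prop
    exact this hS
  rw [uniformBall_apply hmeas, uniformBall_apply hS, mul_left_comm]
  gcongr
  have hsub : {y | midpoint ℝ x y ∈ S} ∩ Metric.ball z r ⊆
      (fun y => (1 / 2 : ℝ) • y) ⁻¹' ((fun y => (1 / 2 : ℝ) • x + y) ⁻¹'
        (S ∩ Metric.ball z r)) := by
    rintro y ⟨hy, hyB⟩
    have hm : (1 / 2 : ℝ) • x + (1 / 2 : ℝ) • y = midpoint ℝ x y := by
      rw [midpoint_eq_smul_add]; simp
    simp only [Set.mem_preimage, hm]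
    exact ⟨hy, (convex_ball z r).midpoint_mem hx hyB⟩
  refine (measure_mono hsub).trans ?_
  rw [Measure.addHaar_preimage_smul volume (by norm_num : (1 / 2 : ℝ) ≠ 0),
    measure_preimage_add]
  gcongr
  simp

end Geometry

/-! ### Decay of superlevel sets forced by the energy. -/

/-- The energy of `v` at unit threshold with respect to the scaled distance `|x - y| / (2 r)`. -/
noncomputable def scaledEnergy {d : ℕ} (a r : ℝ) (μ : Measure (EuclideanSpace ℝ (Fin d)))
    (v : EuclideanSpace ℝ (Fin d) → ℝ) : ℝ≥0∞ :=
  ∫⁻ x, ∫⁻ y, if 1 < |v x - v y| then ENNReal.ofReal ((‖x - y‖ / (2 * r)) ^ (-a)) else 0 ∂μ ∂μ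

section Energy

variable {d : ℕ} {z : EuclideanSpace ℝ (Fin d)} {r a : ℝ} {v : EuclideanSpace ℝ (Fin d) → ℝ}

theorem scaledEnergy_neg (a r : ℝ) (μ : Measure (EuclideanSpace ℝ (Fin d)))
    (v : EuclideanSpace ℝ (Fin d) → ℝ) : scaledEnergy a r μ (-v) = scaledEnergy a r μ v := by
  unfold scaledEnergy
  simp only [Pi.neg_apply, neg_sub_neg, abs_sub_comm]

theorem kernel_lower_bound (hr : 0 < r) (ha : 0 ≤ a) {x y : EuclideanSpace ℝ (Fin d)} {s : ℝ}
    (hxy : dist y x < 2 * r * s) (hne : 1 < |v x - v y|) :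
    ENNReal.ofReal (s ^ (-a)) ≤
      if 1 < |v x - v y| then ENNReal.ofReal ((‖x - y‖ / (2 * r)) ^ (-a)) else 0 := by
  rw [if_pos hne]
  refine ENNReal.ofReal_le_ofReal ?_
  have hne' : x ≠ y := by
    rintro rfl
    norm_num at hne
  have hpos : 0 < ‖x - y‖ := norm_sub_pos_iff.2 hne'
  refine Real.rpow_le_rpow_of_nonpos (by positivity) ?_ (by linarith)
  rw [dist_comm, dist_eq_norm] at hxy
  rw [div_le_iff₀ (by positivity)]
  linarith

/-- A ball around `x` of relative measure at least `2θ`, where `θ` is the mass of `{v > t}`, has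
mass at least `θ` in `{v ≤ t}`. If `v x > t + 1`, all those points interact with `x`, at scaled
distance below `s ~ θ ^ (1 / d)`; integrating `s ^ (-(d + p)) θ` over such `x` gives the power `θ ^
(p / d)`. -/
theorem measureReal_superlevel_succ_le (hd : 1 ≤ d) {p : ℝ} (hp : 0 < p) (hr : 0 < r)
    (hv : Measurable v) {M : ℝ} (hM : 0 ≤ M)
    (hE : scaledEnergy ((d : ℝ) + p) r (uniformBall z r) v ≤ ENNReal.ofReal M) {t : ℝ}
    (ht : (uniformBall z r).real {x | t < v x} ≤ 1 / 2) :
    (uniformBall z r).real {x | t + 1 < v x} ≤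
      2 ^ (1 + p / d) * M * (uniformBall z r).real {x | t < v x} ^ (p / d) := by
  have := isProbabilityMeasure_uniformBall (z := z) hr
  have hd0 : (0 : ℝ) < d := by exact_mod_cast hd
  have hq : 0 < p / d := by positivity
  set μ := uniformBall z r with hμ
  set θ := μ.real {x | t < v x} with hθ
  have hmono : μ.real {x | t + 1 < v x} ≤ θ :=
    measureReal_mono (fun x (hx : t + 1 < v x) => show t < v x by linarith)
  rcases (measureReal_nonneg : 0 ≤ θ).eq_or_lt with h0 | h0
  · have h0' : θ = 0 := h0.symm
    rw [h0', Real.zero_rpow hq.ne', mul_zero]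
    rwa [h0'] at hmono
  -- The radius at which the ball has mass at least `2θ`; `θ ≤ 1 / 2` is what makes `s ≤ 1`.
  set s : ℝ := (2 * θ) ^ (1 / (d : ℝ)) with hs
  have hs0 : 0 < s := by positivity
  have hs1 : s ≤ 1 := Real.rpow_le_one (by positivity) (by linarith) (by positivity)
  have hsd : s ^ d = 2 * θ := by
    rw [hs, ← Real.rpow_natCast, ← Real.rpow_mul (by positivity)]
    field_simp
    simp
  have hmt : MeasurableSet {x | t < v x} := measurableSet_lt measurable_const hv
  have hmt1 : MeasurableSet {x | t + 1 < v x} := measurableSet_lt measurable_const hv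
  have hinner : ∀ x ∈ {x | t + 1 < v x}, x ∈ Metric.ball z r →
      ENNReal.ofReal (s ^ (-((d : ℝ) + p))) * ENNReal.ofReal θ ≤
      ∫⁻ y, if 1 < |v x - v y| then
        ENNReal.ofReal ((‖x - y‖ / (2 * r)) ^ (-((d : ℝ) + p))) else 0 ∂μ := by
    intro x hx hxB
    have hball : ENNReal.ofReal θ ≤ μ (Metric.ball x (2 * r * s) \ {x | t < v x}) := by
      have h1 := uniformBall_ball_ge hr hxB hs0 hs1
      rw [hsd, ← hμ] at h1
      have h2 : μ {x | t < v x} = ENNReal.ofReal θ := by simp [hθ]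
      calc ENNReal.ofReal θ = ENNReal.ofReal (2 * θ) - ENNReal.ofReal θ := by
            rw [← ENNReal.ofReal_sub _ h0.le]; congr 1; ring
        _ ≤ μ (Metric.ball x (2 * r * s)) - μ {x | t < v x} := by
            rw [h2]; exact tsub_le_tsub_right h1 _
        _ ≤ _ := le_measure_sdiff
    calc ENNReal.ofReal (s ^ (-((d : ℝ) + p))) * ENNReal.ofReal θ
        ≤ ENNReal.ofReal (s ^ (-((d : ℝ) + p))) *
          μ (Metric.ball x (2 * r * s) \ {x | t < v x}) := by gcongr
      _ = ∫⁻ y in Metric.ball x (2 * r * s) \ {x | t < v x},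
          ENNReal.ofReal (s ^ (-((d : ℝ) + p))) ∂μ := by rw [setLIntegral_const]
      _ ≤ ∫⁻ y in Metric.ball x (2 * r * s) \ {x | t < v x}, (if 1 < |v x - v y| then
          ENNReal.ofReal ((‖x - y‖ / (2 * r)) ^ (-((d : ℝ) + p))) else 0) ∂μ := by
          refine setLIntegral_mono' (measurableSet_ball.diff hmt) ?_
          rintro y ⟨hy, hyt⟩
          refine kernel_lower_bound hr (by positivity) hy ?_
          simp only [Set.mem_ofPred_eq, not_lt] at hyt hx
          exact lt_of_lt_of_le (by linarith) (le_abs_self _)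
      _ ≤ _ := setLIntegral_le_lintegral _ _
  have hmain : ENNReal.ofReal (s ^ (-((d : ℝ) + p))) * ENNReal.ofReal θ *
      μ {x | t + 1 < v x} ≤ ENNReal.ofReal M := by
    calc _ = ∫⁻ x in {x | t + 1 < v x},
          ENNReal.ofReal (s ^ (-((d : ℝ) + p))) * ENNReal.ofReal θ ∂μ := by
          rw [setLIntegral_const]
      _ ≤ ∫⁻ x in {x | t + 1 < v x}, ∫⁻ y, (if 1 < |v x - v y| then
          ENNReal.ofReal ((‖x - y‖ / (2 * r)) ^ (-((d : ℝ) + p))) else 0) ∂μ ∂μ := by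
          refine lintegral_mono_ae ?_
          filter_upwards [ae_restrict_mem hmt1, ae_restrict_of_ae (ae_uniformBall_mem z r)]
            with x hx hxB using hinner x hx hxB
      _ ≤ _ := setLIntegral_le_lintegral _ _
      _ ≤ _ := hE
  have h2 : μ {x | t + 1 < v x} = ENNReal.ofReal (μ.real {x | t + 1 < v x}) := by simp
  rw [h2, ← ENNReal.ofReal_mul (by positivity), ← ENNReal.ofReal_mul (by positivity),
    ENNReal.ofReal_le_ofReal_iff hM] at hmain
  have hsa : s ^ (-((d : ℝ) + p)) = (2 ^ (1 + p / d) * θ ^ (p / d) * θ)⁻¹ := by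
    rw [hs, ← Real.rpow_mul (by positivity)]
    have : 1 / (d : ℝ) * -((d : ℝ) + p) = -(1 + p / d) := by field_simp
    rw [this, Real.rpow_neg (by positivity), Real.mul_rpow (by norm_num) h0.le,
      Real.rpow_add h0 1, Real.rpow_one]
    ring
  rw [hsa] at hmain
  have hA : 0 < (2 : ℝ) ^ (1 + p / d) * θ ^ (p / d) := by positivity
  have : ((2 : ℝ) ^ (1 + p / d) * θ ^ (p / d) * θ)⁻¹ * θ =
      ((2 : ℝ) ^ (1 + p / d) * θ ^ (p / d))⁻¹ := by
    rw [mul_inv _ θ, mul_assoc, inv_mul_cancel₀ h0.ne', mul_one]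
  rw [this, inv_mul_le_iff₀ hA] at hmain
  linarith

/-- The pairs in `P ×ˢ Q` at distance less than `c`. -/
def closePairs (P Q : Set (EuclideanSpace ℝ (Fin d))) (c : ℝ) :
    Set (EuclideanSpace ℝ (Fin d) × EuclideanSpace ℝ (Fin d)) :=
  {w | w.1 ∈ P ∧ w.2 ∈ Q ∧ dist w.2 w.1 < c}

theorem measurableSet_closePairs {P Q : Set (EuclideanSpace ℝ (Fin d))} (hP : MeasurableSet P)
    (hQ : MeasurableSet Q) (c : ℝ) : MeasurableSet (closePairs P Q c) := by
  have h1 : MeasurableSet {w : EuclideanSpace ℝ (Fin d) × EuclideanSpace ℝ (Fin d) |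
      dist w.2 w.1 < c} := measurableSet_lt (by fun_prop) measurable_const
  exact (measurable_fst hP).inter ((measurable_snd hQ).inter h1)

/-- The midpoint of a pair in `P × Q` lies in `P`, `Q` or `R`. In the first two cases it forms, with
the endpoint in the other set, a pair in `P × Q` at half the distance; the third is charged to `R`.
Each case costs a factor `2 ^ d`. -/
theorem measure_closePairs_le_half (hr : 0 < r) {P Q R : Set (EuclideanSpace ℝ (Fin d))}
    (hP : MeasurableSet P) (hQ : MeasurableSet Q) (hR : MeasurableSet R)
    (hcover : ∀ x, x ∈ P ∨ x ∈ Q ∨ x ∈ R) (c : ℝ) :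
    ((uniformBall z r).prod (uniformBall z r)) (closePairs P Q c) ≤
      2 ^ d * (2 * ((uniformBall z r).prod (uniformBall z r)) (closePairs P Q (c / 2)) +
        uniformBall z r R) := by
  have := isProbabilityMeasure_uniformBall (z := z) hr
  set μ := uniformBall z r with hμ
  set T := closePairs P Q (c / 2) with hT
  have hTm : MeasurableSet T := measurableSet_closePairs hP hQ _
  have hmid : Measurable fun w : EuclideanSpace ℝ (Fin d) × EuclideanSpace ℝ (Fin d) =>
      midpoint ℝ w.1 w.2 := by
    simp only [midpoint_eq_smul_add]
    fun_prop
  set A₁ : Set (EuclideanSpace ℝ (Fin d) × EuclideanSpace ℝ (Fin d)) :=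
    {w | (w.1, midpoint ℝ w.1 w.2) ∈ T} with hA₁
  set A₂ : Set (EuclideanSpace ℝ (Fin d) × EuclideanSpace ℝ (Fin d)) :=
    {w | (midpoint ℝ w.1 w.2, w.2) ∈ T} with hA₂
  set A₃ : Set (EuclideanSpace ℝ (Fin d) × EuclideanSpace ℝ (Fin d)) :=
    {w | midpoint ℝ w.1 w.2 ∈ R} with hA₃
  have hA₁m : MeasurableSet A₁ := (measurable_fst.prodMk hmid) hTm
  have hA₂m : MeasurableSet A₂ := (hmid.prodMk measurable_snd) hTm
  have hA₃m : MeasurableSet A₃ := hmid hR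
  have hsub : closePairs P Q c ⊆ (A₁ ∪ A₂) ∪ A₃ := by
    rintro ⟨x, y⟩ ⟨hx, hy, hxy⟩
    simp only at hx hy hxy
    rcases hcover (midpoint ℝ x y) with h | h | h
    · refine Or.inl (Or.inr ⟨h, hy, ?_⟩)
      simp only
      rw [dist_right_midpoint, dist_comm]
      norm_num
      linarith
    · refine Or.inl (Or.inl ⟨hx, h, ?_⟩)
      simp only
      rw [dist_midpoint_left, dist_comm]
      norm_num
      linarith
    · exact Or.inr h
  have h₁ : (μ.prod μ) A₁ ≤ 2 ^ d * (μ.prod μ) T := by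
    rw [Measure.prod_apply hA₁m, Measure.prod_apply hTm, ← lintegral_const_mul _
      (measurable_measure_prodMk_left hTm)]
    refine lintegral_mono_ae ?_
    filter_upwards [ae_uniformBall_mem z r] with x hx
    exact uniformBall_midpoint_le hx (measurable_prodMk_left hTm)
  have h₂ : (μ.prod μ) A₂ ≤ 2 ^ d * (μ.prod μ) T := by
    rw [Measure.prod_apply_symm hA₂m, Measure.prod_apply_symm hTm, ← lintegral_const_mul _
      (measurable_measure_prodMk_right hTm)]
    refine lintegral_mono_ae ?_
    filter_upwards [ae_uniformBall_mem z r] with y hy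
    have := uniformBall_midpoint_le hy (measurable_prodMk_right (y := y) hTm)
    simp only [midpoint_comm (R := ℝ) y] at this
    exact this
  have h₃ : (μ.prod μ) A₃ ≤ 2 ^ d * μ R := by
    rw [Measure.prod_apply hA₃m]
    calc _ ≤ ∫⁻ _, 2 ^ d * μ R ∂μ := by
          refine lintegral_mono_ae ?_
          filter_upwards [ae_uniformBall_mem z r] with x hx
          exact uniformBall_midpoint_le hx hR
      _ = _ := by simp
  calc (μ.prod μ) (closePairs P Q c) ≤ (μ.prod μ) ((A₁ ∪ A₂) ∪ A₃) := measure_mono hsub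
    _ ≤ (μ.prod μ) A₁ + (μ.prod μ) A₂ + (μ.prod μ) A₃ :=
        (measure_union_le _ _).trans (by gcongr; exact measure_union_le _ _)
    _ ≤ 2 ^ d * (μ.prod μ) T + 2 ^ d * (μ.prod μ) T + 2 ^ d * μ R := by gcongr
    _ = _ := by ring

/-- Carrying the mass of `R` on both sides makes halving a clean recursion: the sum grows by at most
`2 ^ (d + 1)` per step. -/
theorem measure_closePairs_iterate (hr : 0 < r) {P Q R : Set (EuclideanSpace ℝ (Fin d))}
    (hP : MeasurableSet P) (hQ : MeasurableSet Q) (hR : MeasurableSet R)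
    (hcover : ∀ x, x ∈ P ∨ x ∈ Q ∨ x ∈ R) (c : ℝ) (n : ℕ) :
    ((uniformBall z r).prod (uniformBall z r)) (closePairs P Q c) + uniformBall z r R ≤
      (2 ^ (d + 1)) ^ n *
        (((uniformBall z r).prod (uniformBall z r)) (closePairs P Q (c * (1 / 2) ^ n)) +
        uniformBall z r R) := by
  induction n with
  | zero => simp
  | succ n ih =>
    refine ih.trans ?_
    rw [pow_succ (2 ^ (d + 1)) n, mul_assoc ((2 ^ (d + 1)) ^ n)]
    gcongr
    have h := measure_closePairs_le_half (z := z) hr hP hQ hR hcover (c * (1 / 2) ^ n)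
    have hc : c * (1 / 2) ^ n / 2 = c * (1 / 2) ^ (n + 1) := by ring
    rw [hc] at h
    set X := ((uniformBall z r).prod (uniformBall z r)) (closePairs P Q (c * (1 / 2) ^ (n + 1)))
    calc _ ≤ 2 ^ d * (2 * X + uniformBall z r R) + 1 * uniformBall z r R := by
          rw [one_mul]; gcongr
      _ ≤ 2 ^ d * (2 * X + uniformBall z r R) + 2 ^ d * uniformBall z r R := by
          gcongr
          exact one_le_pow₀ (by norm_num)
      _ = _ := by ring

theorem measure_closePairs_le_energy (hr : 0 < r) (ha : 0 ≤ a)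
    {P Q : Set (EuclideanSpace ℝ (Fin d))} (hP : MeasurableSet P) (hQ : MeasurableSet Q)
    (hPQ : ∀ x ∈ P, ∀ y ∈ Q, 1 < |v x - v y|) (s : ℝ) :
    ENNReal.ofReal (s ^ (-a)) *
      ((uniformBall z r).prod (uniformBall z r)) (closePairs P Q (2 * r * s)) ≤
      scaledEnergy a r (uniformBall z r) v := by
  have := isProbabilityMeasure_uniformBall (z := z) hr
  have hTm := measurableSet_closePairs hP hQ (2 * r * s)
  rw [Measure.prod_apply hTm, ← lintegral_const_mul _ (measurable_measure_prodMk_left hTm)]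
  refine lintegral_mono fun x => ?_
  have hS : MeasurableSet (Prod.mk x ⁻¹' closePairs P Q (2 * r * s)) :=
    measurable_prodMk_left hTm
  simp only
  rw [← setLIntegral_const]
  refine (setLIntegral_mono' hS ?_).trans (setLIntegral_le_lintegral _ _)
  rintro y ⟨hx, hy, hxy⟩
  exact kernel_lower_bound hr ha hxy (hPQ x hx y hy)

/-- Midpoint halving with `R = {t < v ≤ t + 1}`: at scale `2 ^ (-n)` the close pairs are controlled
by the energy through a Chebyshev bound. For `p > 1` the gain `2 ^ (-n (d + p))` beats the loss `2 ^
(n (d + 1))`, so a large `n` leaves only the drop of `h`. -/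
theorem measureReal_superlevel_succ_le_diff {p : ℝ} (hp : 0 < p) (hr : 0 < r)
    (hv : Measurable v) {M : ℝ} (hM : 0 ≤ M)
    (hE : scaledEnergy ((d : ℝ) + p) r (uniformBall z r) v ≤ ENNReal.ofReal M) {t : ℝ}
    (ht : (uniformBall z r).real {x | t < v x} ≤ 1 / 2) (n : ℕ) :
    (uniformBall z r).real {x | t + 1 < v x} / 2 ≤
      (2 ^ (d + 1)) ^ n * ((2 ^ n) ^ (-((d : ℝ) + p)) * M +
        ((uniformBall z r).real {x | t < v x} - (uniformBall z r).real {x | t + 1 < v x})) := by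
  have := isProbabilityMeasure_uniformBall (z := z) hr
  set μ := uniformBall z r with hμ
  set P := {x | t + 1 < v x} with hPdef
  set Q := {x | v x ≤ t} with hQdef
  set R := {x | t < v x} \ P with hRdef
  have hmt : MeasurableSet {x | t < v x} := measurableSet_lt measurable_const hv
  have hP : MeasurableSet P := measurableSet_lt measurable_const hv
  have hQ : MeasurableSet Q := measurableSet_le hv measurable_const
  have hR : MeasurableSet R := hmt.diff hP
  have hcover : ∀ x, x ∈ P ∨ x ∈ Q ∨ x ∈ R := by
    intro x
    by_cases h1 : x ∈ P
    · exact Or.inl h1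
    by_cases h2 : x ∈ Q
    · exact Or.inr (Or.inl h2)
    · exact Or.inr (Or.inr ⟨show t < v x from not_le.1 h2, h1⟩)
  have hPQ : ∀ x ∈ P, ∀ y ∈ Q, 1 < |v x - v y| := fun x (hx : t + 1 < v x) y (hy : v y ≤ t) =>
    lt_of_lt_of_le (by linarith) (le_abs_self _)
  have hiter := measure_closePairs_iterate (z := z) hr hP hQ hR hcover (2 * r) n
  have hen := (measure_closePairs_le_energy (z := z) hr (by positivity) hP hQ hPQ
    ((1 / 2) ^ n)).trans hE
  rw [← hμ] at hiter hen
  -- At the starting scale `2r`, the diameter, closeness is no restriction almost everywhere.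
  have hfull : μ P * μ Q ≤ (μ.prod μ) (closePairs P Q (2 * r)) := by
    rw [← Measure.prod_prod]
    refine measure_mono_ae ?_
    have h1 : ∀ᵐ w ∂(μ.prod μ), w.1 ∈ Metric.ball z r :=
      Measure.quasiMeasurePreserving_fst.ae (ae_uniformBall_mem z r)
    have h2 : ∀ᵐ w ∂(μ.prod μ), w.2 ∈ Metric.ball z r :=
      Measure.quasiMeasurePreserving_snd.ae (ae_uniformBall_mem z r)
    filter_upwards [h1, h2] with w hw1 hw2 hw
    refine ⟨hw.1, hw.2, ?_⟩
    rw [Metric.mem_ball] at hw1 hw2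
    linarith [dist_triangle_right w.2 w.1 z]
  set X := (μ.prod μ).real (closePairs P Q (2 * r * (1 / 2) ^ n)) with hX
  have hXe : (μ.prod μ) (closePairs P Q (2 * r * (1 / 2) ^ n)) = ENNReal.ofReal X := by
    simp [hX]
  rw [hXe, ← ENNReal.ofReal_mul (by positivity), ENNReal.ofReal_le_ofReal_iff hM] at hen
  have hs : ((1 / 2 : ℝ) ^ n) ^ (-((d : ℝ) + p)) = ((2 ^ n) ^ (-((d : ℝ) + p)))⁻¹ := by
    rw [one_div, inv_pow, Real.inv_rpow (by positivity)]
  rw [hs, inv_mul_le_iff₀ (by positivity)] at hen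
  have hall : μ P * μ Q ≤ (2 ^ (d + 1)) ^ n * (ENNReal.ofReal X + μ R) := by
    rw [← hXe]
    exact hfull.trans (le_self_add.trans hiter)
  have hall' : μ.real P * μ.real Q ≤ (2 ^ (d + 1)) ^ n * (X + μ.real R) := by
    have h3 := ENNReal.toReal_mono (by finiteness) hall
    rw [ENNReal.toReal_mul, ENNReal.toReal_mul, ENNReal.toReal_add (by finiteness) (by finiteness),
      ENNReal.toReal_ofReal measureReal_nonneg] at h3
    rw [ENNReal.toReal_pow, ENNReal.toReal_pow, ENNReal.toReal_ofNat] at h3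
    exact h3
  have hRr : μ.real R = μ.real {x | t < v x} - μ.real P :=
    measureReal_sdiff (fun x (hx : t + 1 < v x) => show t < v x by linarith) hP
  have hQr : 1 / 2 ≤ μ.real Q := by
    have : Q = {x | t < v x}ᶜ := by ext x; simp [hQdef]
    rw [this, probReal_compl_eq_one_sub hmt]
    linarith
  rw [← hRr]
  calc μ.real P / 2 ≤ μ.real P * μ.real Q := by nlinarith [measureReal_nonneg (μ := μ) (s := P)]
    _ ≤ _ := hall'
    _ ≤ _ := by gcongr

end Energy

/-! ### Medians, iteration of decay estimates, exponential integrals. -/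

section RealAnalysis

theorem exists_median {Ω : Type*} [MeasurableSpace Ω] (μ : Measure Ω) [IsProbabilityMeasure μ]
    {v : Ω → ℝ} (hv : Measurable v) :
    ∃ m : ℝ, μ.real {x | m < v x} ≤ 1 / 2 ∧ μ.real {x | v x < m} ≤ 1 / 2 := by
  have hprob : IsProbabilityMeasure (μ.map v) := Measure.isProbabilityMeasure_map hv.aemeasurable
  set F := ProbabilityTheory.cdf (μ.map v) with hF
  have hFmono : Monotone F := ProbabilityTheory.monotone_cdf _
  set S := {x | 1 / 2 ≤ F x} with hS
  have hne : S.Nonempty :=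
    ((ProbabilityTheory.tendsto_cdf_atTop (μ.map v)).eventually
      (eventually_ge_nhds (by norm_num : (1 / 2 : ℝ) < 1))).exists
  obtain ⟨b, hb⟩ := ((ProbabilityTheory.tendsto_cdf_atBot (μ.map v)).eventually
      (eventually_lt_nhds (by norm_num : (0 : ℝ) < 1 / 2))).exists
  have hbdd : BddBelow S := ⟨b, fun x hx => le_of_not_gt fun hxb =>
    absurd (hFmono hxb.le) (not_le.2 (hb.trans_le hx))⟩
  refine ⟨sInf S, ?_, ?_⟩
  · have hge : 1 / 2 ≤ F (sInf S) := by
      by_contra! hlt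
      have hcont : ContinuousWithinAt F (Set.Ici (sInf S)) (sInf S) := F.right_continuous _
      have hev := hcont.eventually (eventually_lt_nhds hlt)
      have hev' : ∀ᶠ x in nhdsWithin (sInf S) (Set.Ioi (sInf S)), F x < 1 / 2 :=
        nhdsWithin_mono _ Set.Ioi_subset_Ici_self hev
      obtain ⟨x, hx, hxS⟩ := (hev'.and self_mem_nhdsWithin).exists
      obtain ⟨y, hy, hyx⟩ := exists_lt_of_csInf_lt hne hxS
      exact absurd (hFmono hyx.le) (not_le.2 (hx.trans_le hy))
    rw [hF, ProbabilityTheory.cdf_eq_real, map_measureReal_apply hv measurableSet_Iic] at hge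
    have : {x | sInf S < v x} = (v ⁻¹' Set.Iic (sInf S))ᶜ := by ext x; simp
    rw [this, probReal_compl_eq_one_sub (hv measurableSet_Iic)]
    linarith
  · have h1 : (μ.map v) (Set.Iio (sInf S)) ≤ ENNReal.ofReal (1 / 2) := by
      rw [← ProbabilityTheory.measure_cdf (μ.map v),
        StieltjesFunction.measure_Iio _ (ProbabilityTheory.tendsto_cdf_atBot _)]
      refine ENNReal.ofReal_le_ofReal ?_
      rw [sub_zero]
      refine le_of_tendsto (hFmono.tendsto_leftLim (sInf S)) ?_
      filter_upwards [self_mem_nhdsWithin] with x hx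
      exact (not_le.1 fun h => notMem_of_lt_csInf hx hbdd h).le
    rw [Measure.map_apply hv measurableSet_Iio] at h1
    exact ENNReal.toReal_le_of_le_ofReal (by norm_num) h1

/-- `N ^ (-(1 / (q - 1)))` is the positive fixed point of `x ↦ N x ^ q`. Relative to it, each unit
step raises `h` to the power `q`. -/
theorem double_exp_decay {h : ℝ → ℝ} (hanti : Antitone h) (hnn : ∀ t, 0 ≤ h t) {N q b t₀ : ℝ}
    (hN : 0 < N) (hq : 1 < q) (hb : 0 ≤ b)
    (hstep : ∀ t, t₀ ≤ t → h (t + 1) ≤ N * h t ^ q)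
    (hstart : h t₀ ≤ N ^ (-(1 / (q - 1))) * Real.exp (-b)) {t : ℝ} (ht : 0 ≤ t) :
    h (t₀ + t) ≤ N ^ (-(1 / (q - 1))) * Real.exp (-(b / q * q ^ t)) := by
  have hq1 : 0 < q - 1 := by linarith
  set A := N ^ (-(1 / (q - 1))) with hA
  have hApos : 0 < A := by positivity
  have hNA : N * A ^ q = A := by
    rw [hA, ← Real.rpow_mul hN.le]
    nth_rewrite 1 [← Real.rpow_one N]
    rw [← Real.rpow_add hN]
    congr 1
    field_simp
    ring
  have hnat : ∀ k : ℕ, h (t₀ + k) ≤ A * Real.exp (-(b * q ^ k)) := by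
    intro k
    induction k with
    | zero => simpa using hstart
    | succ k ih =>
      have h1 := hstep (t₀ + k) (by linarith [k.cast_nonneg (α := ℝ)])
      rw [add_assoc] at h1
      push_cast
      calc h (t₀ + (k + 1)) ≤ N * h (t₀ + k) ^ q := h1
        _ ≤ N * (A * Real.exp (-(b * q ^ k))) ^ q := by
          gcongr
          exact hnn _
        _ = (N * A ^ q) * Real.exp (-(b * q ^ k) * q) := by
          rw [Real.mul_rpow hApos.le (Real.exp_pos _).le, ← Real.exp_mul]; ring
        _ = A * Real.exp (-(b * q ^ (k + 1))) := by rw [hNA]; ring_nf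
  -- Passing from integer to real `t` loses at most one step, hence `b / q` in place of `b`.
  calc h (t₀ + t) ≤ h (t₀ + ⌊t⌋₊) := hanti (by linarith [Nat.floor_le ht])
    _ ≤ A * Real.exp (-(b * q ^ ⌊t⌋₊)) := hnat _
    _ ≤ _ := by
      have h2 : q ^ (t - 1) ≤ q ^ ⌊t⌋₊ := by
        rw [← Real.rpow_natCast]
        exact Real.rpow_le_rpow_of_exponent_le hq.le (by linarith [Nat.lt_floor_add_one t])
      rw [Real.rpow_sub (by linarith), Real.rpow_one] at h2
      have h3 : b / q * q ^ t ≤ b * q ^ ⌊t⌋₊ := by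
        calc b / q * q ^ t = b * (q ^ t / q) := by ring
          _ ≤ _ := by gcongr
      gcongr

/-- In the layer-cake formula, the factor `2` in the tail exponent turns the measure of the level
set at `w` into at most `A w ^ (-2)`, which is integrable at infinity; below `exp γ` the trivial
bound `1` is enough. -/
theorem lintegral_exp_rpow_le_of_tail {Ω : Type*} [MeasurableSpace Ω] (μ : Measure Ω)
    [IsProbabilityMeasure μ] {X : Ω → ℝ} (hX : Measurable X) {K q γ A : ℝ} (hq : 1 < q)
    (hγ : 0 < γ) (hA : 0 ≤ A)
    (htail : ∀ t, 0 ≤ t → μ.real {x | K + t < X x} ≤ A * Real.exp (-(2 * γ * q ^ t))) :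
    ∫⁻ x, ENNReal.ofReal (Real.exp (γ * q ^ (X x - K))) ∂μ ≤
      ENNReal.ofReal (Real.exp γ + A) := by
  have hq0 : 0 < q := by linarith
  have hmeas : Measurable fun x => Real.exp (γ * q ^ (X x - K)) := by
    have : Measurable fun x => q ^ (X x - K) := by fun_prop
    fun_prop
  rw [lintegral_eq_lintegral_meas_lt μ (Filter.Eventually.of_forall fun x => (Real.exp_pos _).le)
    hmeas.aemeasurable]
  have hpt : ∀ w : ℝ, Real.exp γ < w →
      μ {x | w < Real.exp (γ * q ^ (X x - K))} ≤ ENNReal.ofReal (A * w ^ (-2 : ℝ)) := by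
    intro w hw
    have hw0 : 0 < w := (Real.exp_pos _).trans hw
    have hlog : γ < Real.log w := (Real.lt_log_iff_exp_lt hw0).2 hw
    have h1 : 1 < Real.log w / γ := (one_lt_div hγ).2 hlog
    set t := Real.logb q (Real.log w / γ) with ht
    have ht0 : 0 ≤ t := Real.logb_nonneg hq h1.le
    have hqt : q ^ t = Real.log w / γ := Real.rpow_logb hq0 hq.ne' (by linarith)
    have hsub : {x | w < Real.exp (γ * q ^ (X x - K))} ⊆ {x | K + t < X x} := by
      intro x hx
      have h2 : Real.log w < γ * q ^ (X x - K) := (Real.log_lt_iff_lt_exp hw0).2 hx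
      have h3 : q ^ t < q ^ (X x - K) := by
        rw [hqt, div_lt_iff₀ hγ]; linarith
      have := (Real.rpow_lt_rpow_left_iff hq).1 h3
      show K + t < X x
      linarith
    have h4 := htail t ht0
    have h5 : Real.exp (-(2 * γ * q ^ t)) = w ^ (-2 : ℝ) := by
      rw [hqt, Real.rpow_def_of_pos hw0]
      congr 1
      field_simp
    rw [h5] at h4
    calc _ ≤ μ {x | K + t < X x} := measure_mono hsub
      _ = ENNReal.ofReal (μ.real {x | K + t < X x}) := by simp
      _ ≤ _ := ENNReal.ofReal_le_ofReal h4
  rw [← Set.Ioc_union_Ioi_eq_Ioi (Real.exp_pos γ).le]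
  refine (lintegral_union_le _ _ _).trans ?_
  rw [ENNReal.ofReal_add (Real.exp_pos _).le hA]
  refine add_le_add ?_ ?_
  · calc _ ≤ ∫⁻ _ in Set.Ioc 0 (Real.exp γ), 1 := lintegral_mono fun _ => prob_le_one
      _ = _ := by simp
  · calc _ ≤ ∫⁻ w in Set.Ioi (Real.exp γ), ENNReal.ofReal (A * w ^ (-2 : ℝ)) :=
          setLIntegral_mono' measurableSet_Ioi hpt
      _ = ENNReal.ofReal (∫ w in Set.Ioi (Real.exp γ), A * w ^ (-2 : ℝ)) := by
          refine (ofReal_integral_eq_lintegral_ofReal ?_ ?_).symm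
          · exact (integrableOn_Ioi_rpow_of_lt (by norm_num) (Real.exp_pos γ)).const_mul A
          · filter_upwards [ae_restrict_mem measurableSet_Ioi] with w hw
            have : 0 < w := (Real.exp_pos γ).trans hw
            positivity
      _ ≤ ENNReal.ofReal A := by
          refine ENNReal.ofReal_le_ofReal ?_
          rw [integral_const_mul, integral_Ioi_rpow_of_lt (by norm_num) (Real.exp_pos γ)]
          have h1 : Real.exp γ ^ ((-2 : ℝ) + 1) ≤ 1 := by
            rw [← Real.exp_mul]
            exact Real.exp_le_one_iff.2 (by linarith)
          have h2 : -Real.exp γ ^ ((-2 : ℝ) + 1) / (-2 + 1) = Real.exp γ ^ ((-2 : ℝ) + 1) := by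
            norm_num
          rw [h2]
          nlinarith

/-- A pigeonhole argument: while `h` exceeds the target `ε`, a good choice of the scale `n` makes
each unit step lose a fixed amount, polynomially small in `N`, and the total loss is at most `1`. -/
theorem exists_level_bound (d : ℕ) {p q : ℝ} (hp : 1 < p) (hq : 1 < q) :
    ∃ (C : ℝ) (g : ℕ), ∀ N : ℝ, 1 ≤ N → ∃ K : ℕ, (K : ℝ) ≤ C * N ^ g ∧
      ∀ (M : ℝ) (h : ℝ → ℝ), M ≤ N → Antitone h → (∀ t, 0 ≤ h t) → (h 0 ≤ 1) →
        (∀ t n, 0 ≤ t → h (t + 1) / 2 ≤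
          (2 ^ (d + 1)) ^ (n : ℕ) * ((2 ^ n) ^ (-((d : ℝ) + p)) * M + (h t - h (t + 1)))) →
        h K ≤ N ^ (-(1 / (q - 1))) * Real.exp (-1) := by
  have hq1 : 0 < q - 1 := by linarith
  have hp1 : 0 < p - 1 := by linarith
  set e := 1 / (q - 1) with he
  have he0 : 0 < e := by positivity
  set D : ℝ := 4 * Real.exp 1 with hD
  have hD1 : 1 ≤ D := by
    have := Real.one_le_exp (zero_le_one (α := ℝ)); linarith
  set γ : ℝ := (1 + e) / (p - 1) * (d + 1) + e with hγ
  set C₁ : ℝ := (2 * D ^ (1 / (p - 1))) ^ (d + 1) * D with hC₁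
  have hC₁0 : 0 ≤ C₁ := by positivity
  refine ⟨1 + C₁, ⌈γ⌉₊, fun N hN => ?_⟩
  have hN0 : 0 < N := by linarith
  -- `L = 4N / ε` for the target `ε = N ^ (-e) exp (-1)`; a scale `m` with `m ^ (p - 1) ≥ L` pushes
  -- the energy term below `ε / 4`.
  set L : ℝ := D * N ^ (1 + e) with hL
  have hL1 : 1 ≤ L := one_le_mul_of_one_le_of_one_le hD1
    (Real.one_le_rpow hN (by positivity))
  have hL0 : 0 < L := by linarith
  set y : ℝ := L ^ (1 / (p - 1)) with hy
  have hy1 : 1 ≤ y := Real.one_le_rpow hL1 (by positivity)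
  obtain ⟨n, hn1, hn2⟩ := exists_nat_pow_near hy1 (by norm_num : (1 : ℝ) < 2)
  set m : ℝ := 2 ^ (n + 1) with hm
  have hm0 : 0 < m := by positivity
  have hm2 : m ≤ 2 * y := by rw [hm, pow_succ]; linarith
  have hLm : L ≤ m ^ (p - 1) := by
    calc L = y ^ (p - 1) := by
          rw [hy, ← Real.rpow_mul hL0.le, one_div_mul_cancel hp1.ne', Real.rpow_one]
      _ ≤ _ := Real.rpow_le_rpow (by positivity) hn2.le hp1.le
  -- The reciprocal of the guaranteed drop `ε / (4 m ^ (d + 1))`; more than `B` drops would exceed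
  -- the total mass.
  set B : ℝ := m ^ (d + 1) * (D * N ^ e) with hB
  have hB0 : 0 ≤ B := by positivity
  refine ⟨⌊B⌋₊ + 1, ?_, ?_⟩
  · have h1 : B ≤ C₁ * N ^ γ := by
      calc B ≤ (2 * y) ^ (d + 1) * (D * N ^ e) := by rw [hB]; gcongr
        _ = C₁ * N ^ γ := by
          have h2 : (N ^ ((1 + e) * (1 / (p - 1)))) ^ (d + 1) =
              N ^ ((1 + e) / (p - 1) * (d + 1)) := by
            rw [← Real.rpow_natCast, ← Real.rpow_mul hN0.le]
            congr 1
            push_cast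
            ring
          rw [hy, hL, Real.mul_rpow (by positivity) (by positivity), ← Real.rpow_mul hN0.le,
            hγ, Real.rpow_add hN0, ← h2, hC₁]
          ring
    have h3 : N ^ γ ≤ N ^ ⌈γ⌉₊ := by
      rw [← Real.rpow_natCast]
      exact Real.rpow_le_rpow_of_exponent_le hN (Nat.le_ceil _)
    have h4 : (1 : ℝ) ≤ N ^ ⌈γ⌉₊ := one_le_pow₀ hN
    push_cast
    calc (⌊B⌋₊ : ℝ) + 1 ≤ C₁ * N ^ ⌈γ⌉₊ + N ^ ⌈γ⌉₊ :=
          add_le_add ((Nat.floor_le hB0).trans (h1.trans (by gcongr))) h4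
      _ = _ := by ring
  · intro M h hM hanti hnn h01 hstep
    set ε := N ^ (-e) * Real.exp (-1) with hε
    have hε0 : 0 < ε := by positivity
    have hεinv : 4 / ε = D * N ^ e := by
      rw [hε, hD, Real.rpow_neg hN0.le, Real.exp_neg]
      field_simp
    have hkey : m ^ (d + 1) * (m ^ (-((d : ℝ) + p)) * M) ≤ ε / 4 := by
      have h1 : m ^ (d + 1) * m ^ (-((d : ℝ) + p)) = (m ^ (p - 1))⁻¹ := by
        rw [← Real.rpow_natCast, ← Real.rpow_add hm0, ← Real.rpow_neg hm0.le]
        congr 1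
        push_cast
        ring
      rw [← mul_assoc, h1]
      calc (m ^ (p - 1))⁻¹ * M ≤ (m ^ (p - 1))⁻¹ * N := by gcongr
        _ ≤ L⁻¹ * N := by gcongr
        _ = (4 / ε)⁻¹ := by
          rw [hεinv, hL, Real.rpow_add hN0, Real.rpow_one]
          field_simp
        _ = ε / 4 := inv_div _ _
    have hpow : ((2 : ℝ) ^ (d + 1)) ^ (n + 1) = m ^ (d + 1) := by
      rw [hm, ← pow_mul, ← pow_mul, mul_comm]
    by_contra! hlt
    -- Half of `h (j + 1) > ε`, minus the energy term `ε / 4`, leaves at least `ε / 4` for the drop.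
    have hdrop : ∀ j : ℕ, j < ⌊B⌋₊ + 1 → ε / 4 / m ^ (d + 1) ≤ h j - h (j + 1 : ℕ) := by
      intro j hj
      have h1 := hstep j (n + 1) j.cast_nonneg
      have h2 : h (⌊B⌋₊ + 1 : ℕ) ≤ h ((j : ℝ) + 1) := hanti (by exact_mod_cast hj)
      rw [hpow, ← hm, mul_add] at h1
      rw [div_le_iff₀ (by positivity)]
      push_cast
      linarith
    have hsum : ∑ j ∈ Finset.range (⌊B⌋₊ + 1), ε / 4 / m ^ (d + 1) ≤
        ∑ j ∈ Finset.range (⌊B⌋₊ + 1), (h j - h (j + 1 : ℕ)) :=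
      Finset.sum_le_sum fun j hj => hdrop j (Finset.mem_range.1 hj)
    rw [Finset.sum_range_sub' (fun j : ℕ => h j), Finset.sum_const, Finset.card_range,
      nsmul_eq_mul] at hsum
    have hB' : B = m ^ (d + 1) * (4 / ε) := by rw [hεinv]
    have hfl : B < (⌊B⌋₊ + 1 : ℕ) := by exact_mod_cast Nat.lt_floor_add_one B
    have h3 : B * (ε / 4 / m ^ (d + 1)) = 1 := by rw [hB']; field_simp
    have h4 : 1 < ((⌊B⌋₊ + 1 : ℕ) : ℝ) * (ε / 4 / m ^ (d + 1)) := by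
      rw [← h3]; gcongr
    have h5 := hnn (⌊B⌋₊ + 1 : ℕ)
    have h6 : h ((0 : ℕ) : ℝ) ≤ 1 := by simpa using h01
    linarith

theorem exists_exp_neg_mul_pow_le {c : ℝ} (hc : 0 ≤ c) (g : ℕ) :
    ∃ B : ℝ, 0 < B ∧ ∀ M : ℝ, 0 ≤ M → Real.exp (-M) * (1 + c * M) ^ g ≤ B := by
  refine ⟨(1 + c) ^ g * (g.factorial * Real.exp 1), by positivity, fun M hM => ?_⟩
  have h1 : (1 + M) ^ g ≤ g.factorial * Real.exp (1 + M) := by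
    have := Real.pow_div_factorial_le_exp (1 + M) (by linarith) g
    rwa [div_le_iff₀' (by positivity)] at this
  calc Real.exp (-M) * (1 + c * M) ^ g ≤ Real.exp (-M) * ((1 + c) * (1 + M)) ^ g := by
        gcongr
        nlinarith
    _ = (1 + c) ^ g * (Real.exp (-M) * (1 + M) ^ g) := by rw [mul_pow]; ring
    _ ≤ (1 + c) ^ g * (Real.exp (-M) * (g.factorial * Real.exp (1 + M))) := by gcongr
    _ = _ := by
        rw [mul_left_comm (Real.exp (-M)), ← Real.exp_add]
        congr 3
        ring

end RealAnalysis

/-! ### Normalization, tails of `|v|`, and the two cases of the theorem. -/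

section Assembly

/-- The ratio between the normalized energy and the scaled energy on a ball. -/
noncomputable def energyRatio (d : ℕ) (p : ℝ) : ℝ :=
  volume.real (Metric.ball (0 : EuclideanSpace ℝ (Fin d)) 1) ^ ((p + d) / d) *
    2 ^ (-((d : ℝ) + p))

variable {d : ℕ} {z : EuclideanSpace ℝ (Fin d)} {r p δ : ℝ} {u v : EuclideanSpace ℝ (Fin d) → ℝ}

theorem energyRatio_pos (d : ℕ) (p : ℝ) : 0 < energyRatio d p := by
  have : 0 < volume.real (Metric.ball (0 : EuclideanSpace ℝ (Fin d)) 1) :=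
    ENNReal.toReal_pos (volume_ball_ne_zero one_pos) measure_ball_lt_top.ne
  unfold energyRatio
  positivity

theorem normalizedEnergy_congr {O : Set (EuclideanSpace ℝ (Fin d))}
    (h : u =ᵐ[volume.restrict O] v) :
    normalizedEnergy d δ p u O = normalizedEnergy d δ p v O := by
  unfold normalizedEnergy nonlocalEnergy
  congr 1
  refine lintegral_congr_ae ?_
  filter_upwards [h] with x hx
  refine lintegral_congr_ae ?_
  filter_upwards [h] with y hy
  rw [hx, hy]

theorem normalizedEnergy_ball_eq (hd : 1 ≤ d) (hr : 0 < r) (hδ : 0 < δ) (m : ℝ) :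
    normalizedEnergy d δ p u (Metric.ball z r) = ENNReal.ofReal (energyRatio d p) *
      scaledEnergy ((d : ℝ) + p) r (uniformBall z r) (fun x => (u x - m) / δ) := by
  have hd0 : (0 : ℝ) < d := by exact_mod_cast hd
  set a : ℝ := (d : ℝ) + p with ha
  set V : ℝ := volume.real (Metric.ball z r) with hV
  set ω : ℝ := volume.real (Metric.ball (0 : EuclideanSpace ℝ (Fin d)) 1) with hω
  have hω0 : 0 < ω := ENNReal.toReal_pos (volume_ball_ne_zero one_pos) measure_ball_lt_top.ne
  have hV0 : 0 < V := ENNReal.toReal_pos (volume_ball_ne_zero hr) measure_ball_lt_top.ne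
  have hVω : V = r ^ d * ω := by
    rw [hV, hω, Measure.real, Measure.addHaar_ball_of_pos volume z hr, ENNReal.toReal_mul,
      ENNReal.toReal_ofReal (by positivity), Measure.real, finrank_euclideanSpace_fin]
  have hVe : volume (Metric.ball z r) = ENNReal.ofReal V := by
    rw [hV, ofReal_measureReal measure_ball_lt_top.ne]
  set J : ℝ≥0∞ := ∫⁻ x in Metric.ball z r, ∫⁻ y in Metric.ball z r,
    (if δ < |u x - u y| then ENNReal.ofReal ((‖x - y‖ / (2 * r)) ^ (-a)) else 0) with hJ
  have h1 : nonlocalEnergy d δ p u (Metric.ball z r) =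
      ENNReal.ofReal (δ ^ p * (2 * r) ^ (-a)) * J := by
    unfold nonlocalEnergy
    rw [hJ, ← lintegral_const_mul' _ _ ENNReal.ofReal_ne_top]
    refine lintegral_congr fun x => ?_
    rw [← lintegral_const_mul' _ _ ENNReal.ofReal_ne_top]
    refine lintegral_congr fun y => ?_
    split_ifs
    · rw [← ENNReal.ofReal_mul (by positivity)]
      congr 1
      rw [Real.div_rpow (norm_nonneg _) (by positivity), Real.rpow_neg (norm_nonneg _)]
      have : (2 * r) ^ (-a) ≠ 0 := by positivity
      rw [← ha]
      field_simp
    · simp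
  have h2 : scaledEnergy a r (uniformBall z r) (fun x => (u x - m) / δ) =
      ENNReal.ofReal (V⁻¹ * V⁻¹) * J := by
    have hc : (volume.restrict (Metric.ball z r) Set.univ)⁻¹ = ENNReal.ofReal V⁻¹ := by
      rw [Measure.restrict_apply_univ, hVe, ENNReal.ofReal_inv_of_pos hV0]
    unfold scaledEnergy uniformBall
    rw [hc, lintegral_smul_measure, ENNReal.ofReal_mul (by positivity), mul_assoc, smul_eq_mul,
      hJ]
    congr 1
    rw [← lintegral_const_mul' _ _ ENNReal.ofReal_ne_top]
    refine lintegral_congr fun x => ?_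
    rw [lintegral_smul_measure, smul_eq_mul]
    congr 1
    refine lintegral_congr fun y => ?_
    have : |(u x - m) / δ - (u y - m) / δ| = |u x - u y| / δ := by
      rw [← sub_div, sub_sub_sub_cancel_right, abs_div, abs_of_pos hδ]
    simp only [this, one_lt_div hδ]
  unfold normalizedEnergy
  rw [h1, h2, ← mul_assoc, ← mul_assoc, ← ENNReal.ofReal_mul (by positivity),
    ← ENNReal.ofReal_mul (energyRatio_pos d p).le]
  congr 2
  have h3 : V ^ ((p - d) / d) = V ^ ((p + d) / d) * (V⁻¹ * V⁻¹) := by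
    have : (p - d) / (d : ℝ) = (p + d) / d + (-1) + (-1) := by field_simp; ring
    rw [this, Real.rpow_add hV0, Real.rpow_add hV0, Real.rpow_neg_one]
    ring
  have h4 : V ^ ((p + d) / d) = r ^ a * ω ^ ((p + d) / d) := by
    rw [hVω, Real.mul_rpow (by positivity) hω0.le, ← Real.rpow_natCast,
      ← Real.rpow_mul hr.le]
    congr 2
    field_simp
    rw [ha]; ring
  have h5 : r ^ a * r ^ (-a) = 1 := by
    rw [← Real.rpow_add hr, add_neg_cancel, Real.rpow_zero]
  have h6 : δ ^ (-p) * δ ^ p = 1 := by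
    rw [← Real.rpow_add hδ, neg_add_cancel, Real.rpow_zero]
  have h7 : (2 * r) ^ (-a) = 2 ^ (-a) * r ^ (-a) := Real.mul_rpow (by norm_num) hr.le
  rw [h3, h4, h7, energyRatio]
  calc _ = (r ^ a * r ^ (-a)) * (δ ^ (-p) * δ ^ p) *
        (ω ^ ((p + d) / d) * 2 ^ (-a) * (V⁻¹ * V⁻¹)) := by ring
    _ = _ := by rw [h5, h6, one_mul, one_mul]

/-- Affine normalization: after subtracting a median and dividing by `δ`, a function of bounded
energy becomes a measurable function with median zero and bounded scaled energy. -/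
theorem exists_median_normalization (hd : 1 ≤ d) (hr : 0 < r) (hδ : 0 < δ)
    (hu : AEMeasurable u (volume.restrict (Metric.ball z r))) {M : ℝ}
    (hE : normalizedEnergy d δ p u (Metric.ball z r) ≤ ENNReal.ofReal M) :
    ∃ (m : ℝ) (v : EuclideanSpace ℝ (Fin d) → ℝ), Measurable v ∧
      (u =ᵐ[volume.restrict (Metric.ball z r)] fun x => m + δ * v x) ∧
      (uniformBall z r).real {x | 0 < v x} ≤ 1 / 2 ∧
      (uniformBall z r).real {x | 0 < (-v) x} ≤ 1 / 2 ∧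
      scaledEnergy ((d : ℝ) + p) r (uniformBall z r) v ≤
        ENNReal.ofReal ((energyRatio d p)⁻¹ * M) := by
  have := isProbabilityMeasure_uniformBall (z := z) hr
  obtain ⟨m, hm1, hm2⟩ := exists_median (uniformBall z r) hu.measurable_mk
  refine ⟨m, fun x => (hu.mk u x - m) / δ, (hu.measurable_mk.sub_const m).div_const δ,
    ?_, ?_, ?_, ?_⟩
  · filter_upwards [hu.ae_eq_mk] with x hx
    rw [hx]
    field_simp
    ring
  · convert hm1 using 4 with x
    rw [lt_div_iff₀ hδ, zero_mul, sub_pos]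
  · convert hm2 using 4 with x
    simp only [Pi.neg_apply]
    rw [← neg_div, lt_div_iff₀ hδ, zero_mul, neg_sub, sub_pos]
  · rw [normalizedEnergy_congr hu.ae_eq_mk, normalizedEnergy_ball_eq hd hr hδ m] at hE
    have hκ := energyRatio_pos d p
    rw [ENNReal.ofReal_mul (by positivity), ENNReal.ofReal_inv_of_pos hκ, mul_comm,
      ← div_eq_mul_inv, ENNReal.le_div_iff_mul_le (Or.inl (by simpa using hκ))
        (Or.inl ENNReal.ofReal_ne_top), mul_comm]
    exact hE

theorem doubleExpAverage_eq {α β m : ℝ} (hr : 0 < r) (hδ : 0 < δ)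
    (huv : u =ᵐ[volume.restrict (Metric.ball z r)] fun x => m + δ * v x)
    (hv : Integrable v (uniformBall z r)) :
    IntegrableOn u (Metric.ball z r) ∧
      doubleExpAverage d δ p α β u (Metric.ball z r) =
        ∫⁻ x, ENNReal.ofReal (Real.exp (α * (p / d) ^
          (β * |v x - ∫ y, v y ∂(uniformBall z r)|))) ∂(uniformBall z r) := by
  have := isProbabilityMeasure_uniformBall (z := z) hr
  have huv' : u =ᵐ[uniformBall z r] fun x => m + δ * v x := Measure.ae_smul_measure huv _
  have hint : Integrable u (uniformBall z r) :=
    ((integrable_const m).add (hv.const_mul δ)).congr huv'.symm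
  constructor
  · refine (integrable_smul_measure ?_ ?_).1 hint
    · rw [Measure.restrict_apply_univ]
      exact ENNReal.inv_ne_zero.2 measure_ball_lt_top.ne
    · rw [Measure.restrict_apply_univ]
      exact ENNReal.inv_ne_top.2 (volume_ball_ne_zero hr)
  · have havg : ⨍ y in Metric.ball z r, u y ∂volume =
        m + δ * ∫ y, v y ∂(uniformBall z r) := by
      calc _ = ∫ y, u y ∂(uniformBall z r) := rfl
        _ = ∫ y, (m + δ * v y) ∂(uniformBall z r) := integral_congr_ae huv'
        _ = _ := by
          rw [integral_add (integrable_const m) (hv.const_mul δ), integral_const_mul]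
          simp
    unfold doubleExpAverage
    rw [havg]
    refine lintegral_congr_ae ?_
    filter_upwards [huv'] with x hx
    have : β * δ⁻¹ * |u x - (m + δ * ∫ y, v y ∂(uniformBall z r))| =
        β * |v x - ∫ y, v y ∂(uniformBall z r)| := by
      rw [hx, add_sub_add_left_eq_sub, ← mul_sub, abs_mul, abs_of_pos hδ]
      field_simp
    rw [this]

theorem measureReal_abs_tail_le (hd : 1 ≤ d) (hp : (d : ℝ) < p) (hr : 0 < r) (hv : Measurable v)
    {M N K b : ℝ} (hM : 0 ≤ M) (hN : 0 < N) (hMN : 2 ^ (1 + p / d) * M ≤ N) (hK : 0 ≤ K)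
    (hb : 0 ≤ b) (hE : scaledEnergy ((d : ℝ) + p) r (uniformBall z r) v ≤ ENNReal.ofReal M)
    (hpos : (uniformBall z r).real {x | 0 < v x} ≤ 1 / 2)
    (hneg : (uniformBall z r).real {x | 0 < (-v) x} ≤ 1 / 2)
    (hposK : (uniformBall z r).real {x | K < v x} ≤
      N ^ (-(1 / (p / d - 1))) * Real.exp (-b))
    (hnegK : (uniformBall z r).real {x | K < (-v) x} ≤
      N ^ (-(1 / (p / d - 1))) * Real.exp (-b)) {t : ℝ} (ht : 0 ≤ t) :
    (uniformBall z r).real {x | K + t < |v x|} ≤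
      2 * N ^ (-(1 / (p / d - 1))) * Real.exp (-(b / (p / d) * (p / d) ^ t)) := by
  have := isProbabilityMeasure_uniformBall (z := z) hr
  have hd0 : (0 : ℝ) < d := by exact_mod_cast hd
  have hq : 1 < p / d := (one_lt_div hd0).2 hp
  have one_sided : ∀ w : EuclideanSpace ℝ (Fin d) → ℝ, Measurable w →
      scaledEnergy ((d : ℝ) + p) r (uniformBall z r) w ≤ ENNReal.ofReal M →
      (uniformBall z r).real {x | 0 < w x} ≤ 1 / 2 →
      (uniformBall z r).real {x | K < w x} ≤ N ^ (-(1 / (p / d - 1))) * Real.exp (-b) →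
      (uniformBall z r).real {x | K + t < w x} ≤
        N ^ (-(1 / (p / d - 1))) * Real.exp (-(b / (p / d) * (p / d) ^ t)) := by
    intro w hw hEw hw0 hwK
    have hanti : Antitone fun t => (uniformBall z r).real {x | t < w x} := fun s t hst =>
      measureReal_mono fun x (hx : t < w x) => show s < w x by linarith
    refine double_exp_decay (h := fun t => (uniformBall z r).real {x | t < w x}) hanti
      (fun _ => measureReal_nonneg) hN hq hb (fun s hs => ?_) hwK ht
    refine (measureReal_superlevel_succ_le hd (by linarith) hr hw hM hEw
      ((hanti (hK.trans hs)).trans hw0)).trans ?_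
    gcongr
  have hsub : {x | K + t < |v x|} ⊆ {x | K + t < v x} ∪ {x | K + t < (-v) x} := by
    intro x hx
    have hx' : K + t < |v x| := hx
    exact lt_abs.1 hx'
  calc _ ≤ (uniformBall z r).real ({x | K + t < v x} ∪ {x | K + t < (-v) x}) :=
        measureReal_mono hsub
    _ ≤ _ := measureReal_union_le _ _
    _ ≤ _ := add_le_add (one_sided v hv hE hpos hposK)
        (one_sided (-v) hv.neg (by rwa [scaledEnergy_neg]) hneg hnegK)
    _ = _ := by ring

/-- `x + 1 ≤ exp x`, used twice, bounds `|v| - K` by a multiple of its double exponential. The mean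
then exceeds `K` by at most a constant free of `K`, which is how the median is traded for the mean.
-/
theorem integrable_of_abs_tail {Ω : Type*} [MeasurableSpace Ω] (μ : Measure Ω)
    [IsProbabilityMeasure μ] {v : Ω → ℝ} (hv : Measurable v) {K q γ A : ℝ} (hq : 1 < q)
    (hγ : 0 < γ) (hA : 0 ≤ A)
    (htail : ∀ t, 0 ≤ t → μ.real {x | K + t < |v x|} ≤ A * Real.exp (-(2 * γ * q ^ t))) :
    Integrable v μ ∧ |∫ x, v x ∂μ| ≤ K + (Real.exp γ + A) / (γ * Real.log q) := by
  have hq0 : 0 < q := by linarith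
  have hlog : 0 < Real.log q := Real.log_pos hq
  have hX : Measurable fun x => |v x| := hv.abs
  set W := fun x => Real.exp (γ * q ^ (|v x| - K)) with hW
  have hWm : Measurable W := by
    have : Measurable fun x => q ^ (|v x| - K) := by fun_prop
    fun_prop
  have hlint := lintegral_exp_rpow_le_of_tail μ hX hq hγ hA htail
  have hWi : Integrable W μ :=
    (lintegral_ofReal_ne_top_iff_integrable hWm.aestronglyMeasurable
      (Filter.Eventually.of_forall fun x => (Real.exp_pos _).le)).1
      (ne_top_of_le_ne_top ENNReal.ofReal_ne_top hlint)
  have hWint : ∫ x, W x ∂μ ≤ Real.exp γ + A := by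
    rw [integral_eq_lintegral_of_nonneg_ae
      (Filter.Eventually.of_forall fun x => (Real.exp_pos _).le) hWm.aestronglyMeasurable]
    exact ENNReal.toReal_le_of_le_ofReal (by positivity) hlint
  have hpt : ∀ x, |v x| ≤ K + (γ * Real.log q)⁻¹ * W x := by
    intro x
    have h1 : (|v x| - K) * Real.log q ≤ q ^ (|v x| - K) := by
      rw [Real.rpow_def_of_pos hq0]
      nlinarith [Real.add_one_le_exp (Real.log q * (|v x| - K))]
    have h2 : γ * q ^ (|v x| - K) ≤ W x := by
      have := Real.add_one_le_exp (γ * q ^ (|v x| - K))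
      simp only [hW]; linarith
    have h3 : |v x| - K ≤ (γ * Real.log q)⁻¹ * W x := by
      rw [← div_eq_inv_mul, le_div_iff₀ (by positivity)]
      calc _ = γ * ((|v x| - K) * Real.log q) := by ring
        _ ≤ γ * q ^ (|v x| - K) := by gcongr
        _ ≤ _ := h2
    linarith
  have hdom : Integrable (fun x => K + (γ * Real.log q)⁻¹ * W x) μ :=
    (integrable_const K).add (hWi.const_mul _)
  have hvi : Integrable v μ := hdom.mono' hv.aestronglyMeasurable
    (Filter.Eventually.of_forall hpt)
  refine ⟨hvi, ?_⟩
  calc |∫ x, v x ∂μ| ≤ ∫ x, |v x| ∂μ := abs_integral_le_integral_abs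
    _ ≤ ∫ x, (K + (γ * Real.log q)⁻¹ * W x) ∂μ := integral_mono hvi.abs hdom hpt
    _ = K + (γ * Real.log q)⁻¹ * ∫ x, W x ∂μ := by
      rw [integral_add (integrable_const K) (hWi.const_mul _), integral_const_mul]
      simp
    _ ≤ K + (γ * Real.log q)⁻¹ * (Real.exp γ + A) := by gcongr
    _ = _ := by rw [div_eq_inv_mul]

/-- Replacing the mean by `0` and recentring at `K` costs `β (2K + a)` in the exponent; bounding `β
K` keeps the resulting factor independent of `K`. -/
theorem mul_rpow_deviation_le {q α β K K₁ a x c : ℝ} (hq : 1 < q) (hα : 0 < α) (hβ0 : 0 ≤ β)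
    (hβ1 : β ≤ 1) (ha : 0 ≤ a) (hβK : β * K ≤ K₁) (hc : |c| ≤ K + a) :
    α * q ^ (β * |x - c|) ≤ α * q ^ (2 * K₁ + a) * q ^ (β * (|x| - K)) := by
  rw [mul_assoc, ← Real.rpow_add (by linarith)]
  gcongr
  · exact hq.le
  · have h1 : |x - c| ≤ |x| + |c| := abs_sub _ _
    have h2 : β * |x - c| ≤ β * (|x| - K + (2 * K + a)) := by gcongr; linarith
    nlinarith

/-- For `β ≤ 1 / 2` the left side grows at most like the square root of `q ^ s`, so Young's
inequality absorbs it into an arbitrarily small multiple of `q ^ s`. -/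
theorem mul_rpow_le_add_of_le_half {q A β γ s : ℝ} (hq : 1 < q) (hA : 0 ≤ A) (hβ0 : 0 ≤ β)
    (hβ : β ≤ 1 / 2) (hγ : 0 < γ) :
    A * q ^ (β * s) ≤ A + A ^ 2 / (4 * γ) + γ * q ^ s := by
  have hq0 : 0 < q := by linarith
  have h1 : q ^ (β * s) ≤ 1 + q ^ (s / 2) := by
    rcases le_total 0 s with hs | hs
    · have : q ^ (β * s) ≤ q ^ (s / 2) :=
        Real.rpow_le_rpow_of_exponent_le hq.le (by nlinarith)
      linarith
    · have : q ^ (β * s) ≤ 1 := Real.rpow_le_one_of_one_le_of_nonpos hq.le (by nlinarith)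
      have : 0 < q ^ (s / 2) := by positivity
      linarith
  have h2 : q ^ s = (q ^ (s / 2)) ^ 2 := by
    rw [← Real.rpow_natCast, ← Real.rpow_mul hq0.le]
    congr 1
    push_cast
    ring
  set y := q ^ (s / 2)
  have h3 : A * y ≤ A ^ 2 / (4 * γ) + γ * y ^ 2 := by
    have : A ^ 2 / (4 * γ) + γ * y ^ 2 - A * y = (A - 2 * γ * y) ^ 2 / (4 * γ) := by
      field_simp
      ring
    have h4 : 0 ≤ (A - 2 * γ * y) ^ 2 / (4 * γ) := by positivity
    linarith
  rw [h2]
  nlinarith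

theorem exists_bound_of_bounded_energy (hd : 1 ≤ d) (hp : (d : ℝ) < p) {α : ℝ} (hα : 0 < α) :
    ∃ C : ℝ, 0 < C ∧ ∀ M : ℝ, 0 < M →
      ∀ (δ : ℝ) (z : EuclideanSpace ℝ (Fin d)) (r : ℝ), 0 < δ → 0 < r →
      ∀ u : EuclideanSpace ℝ (Fin d) → ℝ,
        AEMeasurable u (volume.restrict (Metric.ball z r)) →
        normalizedEnergy d δ p u (Metric.ball z r) ≤ ENNReal.ofReal M →
        IntegrableOn u (Metric.ball z r) ∧
          doubleExpAverage d δ p α (Real.exp (-M) / 2) u (Metric.ball z r) ≤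
            ENNReal.ofReal C := by
  have hd0 : (0 : ℝ) < d := by exact_mod_cast hd
  have hd1 : (1 : ℝ) ≤ d := by exact_mod_cast hd
  set q := p / d with hqdef
  have hq : 1 < q := (one_lt_div hd0).2 hp
  have hq0 : 0 < q := by linarith
  have hκ := energyRatio_pos d p
  set κ := energyRatio d p
  obtain ⟨C₀, g, hlevel⟩ := exists_level_bound d (hd1.trans_lt hp) hq
  set c : ℝ := 2 ^ (1 + q) * κ⁻¹ with hc
  have hc0 : 0 < c := by positivity
  obtain ⟨B, hB0, hB⟩ := exists_exp_neg_mul_pow_le hc0.le g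
  -- Half of the decay rate `b / q` for `b = 1`; it does not involve `α`, since the factor `A` is
  -- absorbed later.
  set γ : ℝ := 1 / (2 * q) with hγ
  have hγ0 : 0 < γ := by positivity
  set S : ℝ := Real.exp γ + 2 with hS
  have hS0 : 0 < S := by positivity
  set a : ℝ := S / (γ * Real.log q) with ha
  have ha0 : 0 ≤ a := by have := Real.log_pos hq; positivity
  set A : ℝ := α * q ^ (2 * (|C₀| * B) + a) with hA
  have hA0 : 0 < A := by positivity
  refine ⟨Real.exp (A + A ^ 2 / (4 * γ)) * S, by positivity, ?_⟩
  intro M hM δ z r hδ hr u hu hE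
  have := isProbabilityMeasure_uniformBall (z := z) hr
  obtain ⟨m, v, hv, huv, hpos, hneg, hEv⟩ := exists_median_normalization hd hr hδ hu hE
  have hκM : 0 ≤ κ⁻¹ * M := by positivity
  set N : ℝ := 1 + c * M with hN
  have hN1 : 1 ≤ N := by
    have : 0 ≤ c * M := by positivity
    linarith
  have hMN : 2 ^ (1 + q) * (κ⁻¹ * M) ≤ N := by rw [hN, hc]; linarith
  have hMN' : κ⁻¹ * M ≤ N := by
    have : (1 : ℝ) ≤ 2 ^ (1 + q) := Real.one_le_rpow (by norm_num) (by linarith)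
    nlinarith
  obtain ⟨K, hKle, hK⟩ := hlevel N hN1
  have hlev : ∀ w : EuclideanSpace ℝ (Fin d) → ℝ, Measurable w →
      scaledEnergy ((d : ℝ) + p) r (uniformBall z r) w ≤ ENNReal.ofReal (κ⁻¹ * M) →
      (uniformBall z r).real {x | 0 < w x} ≤ 1 / 2 →
      (uniformBall z r).real {x | (K : ℝ) < w x} ≤ N ^ (-(1 / (q - 1))) * Real.exp (-1) := by
    intro w hw hEw hw0
    have hanti : Antitone fun t => (uniformBall z r).real {x | t < w x} := fun s t hst =>
      measureReal_mono fun x (hx : t < w x) => show s < w x by linarith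
    exact hK (κ⁻¹ * M) (fun t => (uniformBall z r).real {x | t < w x}) hMN' hanti
      (fun _ => measureReal_nonneg) measureReal_le_one fun t n ht =>
        measureReal_superlevel_succ_le_diff (by linarith) hr hw hκM hEw
          ((hanti ht).trans hw0) n
  -- Because `N ≥ 1`, the prefactor of the tail can be dropped, which makes the bound free of `M`
  -- apart from the shift `K`.
  have hNe : N ^ (-(1 / (q - 1))) ≤ 1 :=
    Real.rpow_le_one_of_one_le_of_nonpos hN1 (by
      have : 0 < 1 / (q - 1) := one_div_pos.2 (by linarith)
      linarith)
  have htail : ∀ t, 0 ≤ t → (uniformBall z r).real {x | (K : ℝ) + t < |v x|} ≤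
      2 * Real.exp (-(2 * γ * q ^ t)) := by
    intro t ht
    refine (measureReal_abs_tail_le hd hp hr hv hκM (by linarith) hMN K.cast_nonneg zero_le_one
      hEv hpos hneg (hlev v hv hEv hpos)
      (hlev (-v) hv.neg (by rwa [scaledEnergy_neg]) hneg) ht).trans ?_
    have : 2 * γ = 1 / q := by rw [hγ]; field_simp
    rw [this]
    gcongr
    linarith
  obtain ⟨hvi, hmean⟩ := integrable_of_abs_tail (uniformBall z r) hv hq hγ0 zero_le_two
    htail
  obtain ⟨hui, hav⟩ := doubleExpAverage_eq (p := p) (α := α) (β := Real.exp (-M) / 2) hr hδ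
    huv hvi
  refine ⟨hui, ?_⟩
  rw [hav]
  set β := Real.exp (-M) / 2 with hβ
  have hβ0 : 0 ≤ β := by positivity
  have hβ1 : β ≤ 1 / 2 := by
    have : Real.exp (-M) ≤ 1 := Real.exp_le_one_iff.2 (by linarith)
    linarith
  have hβK : β * K ≤ |C₀| * B := by
    calc β * K ≤ Real.exp (-M) * K := by
          gcongr
          have := Real.exp_pos (-M)
          linarith
      _ ≤ Real.exp (-M) * (|C₀| * N ^ g) := by
          gcongr
          refine hKle.trans ?_
          gcongr
          exact le_abs_self _
      _ = |C₀| * (Real.exp (-M) * N ^ g) := by ring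
      _ ≤ _ := by gcongr; exact hB M hM.le
  calc _ ≤ ∫⁻ x, ENNReal.ofReal (Real.exp (A + A ^ 2 / (4 * γ))) *
        ENNReal.ofReal (Real.exp (γ * q ^ (|v x| - K))) ∂(uniformBall z r) := by
        refine lintegral_mono fun x => ?_
        rw [← ENNReal.ofReal_mul (Real.exp_pos _).le, ← Real.exp_add]
        refine ENNReal.ofReal_le_ofReal (Real.exp_le_exp.2 ?_)
        exact (mul_rpow_deviation_le hq hα hβ0 (by linarith) ha0 hβK hmean).trans
          (mul_rpow_le_add_of_le_half hq hA0.le hβ0 hβ1 hγ0)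
    _ = ENNReal.ofReal (Real.exp (A + A ^ 2 / (4 * γ))) *
        ∫⁻ x, ENNReal.ofReal (Real.exp (γ * q ^ (|v x| - K))) ∂(uniformBall z r) :=
        lintegral_const_mul' _ _ ENNReal.ofReal_ne_top
    _ ≤ ENNReal.ofReal (Real.exp (A + A ^ 2 / (4 * γ))) * ENNReal.ofReal S := by
        gcongr
        exact lintegral_exp_rpow_le_of_tail _ hv.abs hq hγ0 zero_le_two htail
    _ = _ := (ENNReal.ofReal_mul (Real.exp_pos _).le).symm

theorem exists_bound_of_small_energy (hd : 1 ≤ d) (hp : (d : ℝ) < p) {α : ℝ} (hα : 0 < α) :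
    ∃ C : ℝ, 0 < C ∧ ∃ M₀ : ℝ, 0 < M₀ ∧
      ∀ (δ : ℝ) (z : EuclideanSpace ℝ (Fin d)) (r : ℝ), 0 < δ → 0 < r →
      ∀ u : EuclideanSpace ℝ (Fin d) → ℝ,
        AEMeasurable u (volume.restrict (Metric.ball z r)) →
        normalizedEnergy d δ p u (Metric.ball z r) ≤ ENNReal.ofReal M₀ →
        IntegrableOn u (Metric.ball z r) ∧
          doubleExpAverage d δ p α 1 u (Metric.ball z r) ≤ ENNReal.ofReal C := by
  have hd0 : (0 : ℝ) < d := by exact_mod_cast hd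
  set q := p / d with hqdef
  have hq : 1 < q := (one_lt_div hd0).2 hp
  have hq0 : 0 < q := by linarith
  have hκ := energyRatio_pos d p
  set κ := energyRatio d p with hκdef
  have hlog := Real.log_pos hq
  -- The bound on the mean from the tail with `s = 1`. It is fixed before `b`, which must be large
  -- in terms of `a`; otherwise the choice would be circular.
  set a : ℝ := (Real.exp (1 / (2 * q)) + Real.exp 1) / (1 / (2 * q) * Real.log q) with ha
  have ha0 : 0 ≤ a := by positivity
  set A : ℝ := α * q ^ a with hA
  -- With `β = 1` nothing can be absorbed, so the decay rate itself must dominate `A`.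
  set b : ℝ := max 1 (2 * q * A) with hb
  have hb1 : 1 ≤ b := le_max_left _ _
  set γ : ℝ := b / (2 * q) with hγ
  have hγ0 : 0 < γ := by positivity
  have hAγ : A ≤ γ := by
    rw [hγ, le_div_iff₀ (by positivity)]
    linarith [le_max_right 1 (2 * q * A)]
  -- The value of `N` for which `N ^ (-(1 / (q - 1))) exp (-s) = 1 / 2`, so that the median bound
  -- alone starts the iteration at level `0`.
  set threshold : ℝ → ℝ := fun s => (Real.exp s / 2) ^ (-(q - 1)) with hthreshold
  have hthr0 : ∀ s, 0 < threshold s := fun s => by simp only [hthreshold]; positivity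
  have hthr_pow : ∀ s, threshold s ^ (-(1 / (q - 1))) = Real.exp s / 2 := by
    intro s
    have : q - 1 ≠ 0 := by linarith
    simp only [hthreshold]
    rw [← Real.rpow_mul (by positivity)]
    have : -(q - 1) * -(1 / (q - 1)) = 1 := by field_simp
    rw [this, Real.rpow_one]
  refine ⟨Real.exp γ + Real.exp b, by positivity,
    threshold b * κ / 2 ^ (1 + q), by have := hthr0 b; positivity, ?_⟩
  intro δ z r hδ hr u hu hE
  have := isProbabilityMeasure_uniformBall (z := z) hr
  obtain ⟨m, v, hv, huv, hpos, hneg, hEv⟩ := exists_median_normalization hd hr hδ hu hE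
  rw [← hκdef] at hEv
  set M : ℝ := κ⁻¹ * (threshold b * κ / 2 ^ (1 + q)) with hM
  have hM0 : 0 ≤ M := by have := hthr0 b; positivity
  have hMb : 2 ^ (1 + q) * M = threshold b := by rw [hM]; field_simp
  -- `threshold` is decreasing, so one energy bound serves both `s = 1`, for the mean, and `s = b`,
  -- for the final integral.
  have htail : ∀ s, 1 ≤ s → s ≤ b → ∀ t, 0 ≤ t →
      (uniformBall z r).real {x | 0 + t < |v x|} ≤
        Real.exp s * Real.exp (-(2 * (s / (2 * q)) * q ^ t)) := by
    intro s hs1 hsb t ht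
    have hle : threshold b ≤ threshold s := by
      refine Real.rpow_le_rpow_of_nonpos (by positivity) ?_ (by linarith)
      gcongr
    have hhalf : threshold s ^ (-(1 / (q - 1))) * Real.exp (-s) = 1 / 2 := by
      rw [hthr_pow, Real.exp_neg]
      have := Real.exp_pos s
      field_simp
    refine (measureReal_abs_tail_le hd hp hr hv hM0 (hthr0 s) (hMb.le.trans hle) le_rfl
      (by linarith : 0 ≤ s) hEv hpos hneg (hpos.trans hhalf.ge) (hneg.trans hhalf.ge)
      ht).trans (le_of_eq ?_)
    rw [← hqdef, hthr_pow]
    have : 2 * (s / (2 * q)) = s / q := by field_simp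
    rw [this]
    ring
  obtain ⟨hvi, hmean⟩ := integrable_of_abs_tail (uniformBall z r) hv hq (by positivity)
    (Real.exp_pos 1).le (htail 1 le_rfl hb1)
  obtain ⟨hui, hav⟩ := doubleExpAverage_eq (p := p) (α := α) (β := 1) hr hδ huv hvi
  refine ⟨hui, ?_⟩
  rw [hav]
  refine le_trans (lintegral_mono fun x => ?_)
    (lintegral_exp_rpow_le_of_tail _ hv.abs hq hγ0 (Real.exp_pos b).le (htail b hb1 le_rfl))
  refine ENNReal.ofReal_le_ofReal (Real.exp_le_exp.2 ?_)
  refine (mul_rpow_deviation_le (K₁ := 0) hq hα zero_le_one le_rfl ha0 (by simp) hmean).trans ?_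
  rw [mul_zero, zero_add, one_mul]
  gcongr

end Assembly

theorem theorem1 :
    ∃ β : ℝ → ℝ → ℝ,
      (∀ α M : ℝ, 0 < α → 0 < M → 0 < β α M ∧ β α M ≤ 1) ∧
      ∀ (d : ℕ) (p α : ℝ), 1 ≤ d → (d : ℝ) < p → 0 < α →
        ∃ C : ℝ, 0 < C ∧
          -- part (i)
          (∀ M : ℝ, 0 < M →
            ∀ (δ : ℝ) (z : EuclideanSpace ℝ (Fin d)) (r : ℝ), 0 < δ → 0 < r →
            ∀ u : EuclideanSpace ℝ (Fin d) → ℝ,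
              AEMeasurable u (volume.restrict (Metric.ball z r)) →
              normalizedEnergy d δ p u (Metric.ball z r) ≤ ENNReal.ofReal M →
              IntegrableOn u (Metric.ball z r) ∧
                doubleExpAverage d δ p α (β α M) u (Metric.ball z r) ≤ ENNReal.ofReal C) ∧
          -- part (ii)
          (∃ M₀ : ℝ, 0 < M₀ ∧
            ∀ (δ : ℝ) (z : EuclideanSpace ℝ (Fin d)) (r : ℝ), 0 < δ → 0 < r →
            ∀ u : EuclideanSpace ℝ (Fin d) → ℝ,
              AEMeasurable u (volume.restrict (Metric.ball z r)) →
              normalizedEnergy d δ p u (Metric.ball z r) ≤ ENNReal.ofReal M₀ →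
              IntegrableOn u (Metric.ball z r) ∧
                doubleExpAverage d δ p α 1 u (Metric.ball z r) ≤ ENNReal.ofReal C) := by
  refine ⟨fun _ M => Real.exp (-M) / 2, fun α M _ hM => ⟨by positivity, ?_⟩, ?_⟩
  · have : Real.exp (-M) ≤ 1 := Real.exp_le_one_iff.2 (by linarith)
    linarith
  · intro d p α hd hp hα
    obtain ⟨C₁, hC₁, h₁⟩ := exists_bound_of_bounded_energy hd hp hα
    obtain ⟨C₂, hC₂, M₀, hM₀, h₂⟩ := exists_bound_of_small_energy hd hp hα
    refine ⟨C₁ + C₂, by positivity, ?_, M₀, hM₀, ?_⟩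
    · intro M hM δ z r hδ hr u hu hE
      obtain ⟨hi, hle⟩ := h₁ M hM δ z r hδ hr u hu hE
      exact ⟨hi, hle.trans (ENNReal.ofReal_le_ofReal (by linarith))⟩
    · intro δ z r hδ hr u hu hE
      obtain ⟨hi, hle⟩ := h₂ δ z r hδ hr u hu hE
      exact ⟨hi, hle.trans (ENNReal.ofReal_le_ofReal (by linarith))⟩
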